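/- Let $\zeta_1=1$, $\zeta_2=\tfrac12(-1+i\sqrt3)$, $\zeta_3=\tfrac12(-1-i\sqrt3)$, $l_{\zeta_k}=\{x\zeta_k:x>0\}$, $l=\bigcup_k l_{\zeta_k}$, $L_{\zeta_k}=\{x\zeta_k:x\in\mathbb R\}$, $L=\bigcup_kL_{\zeta_k}$. Let $L^2(l)$ be the Hilbert space of (classes of) functions $f$ on $l$ with $\|f\|^2=\sum_{k=1}^3\int_0^\infty|f(x\zeta_k)|^2dx<\infty$, let $L^2(L)$ be the Hilbert space of (classes of) functions $h$ on $L$ with $\|h\|^2=\sum_{k=1}^3\int_{\mathbb R}|h(x\zeta_k)|^2dx<\infty$, and let $$L^2(l,\infty)=\Big\{f\in L^2(l):\ \sum_{k=1}^3\int_0^\infty e^{2ax}|f(x\zeta_k)|^2dx<\infty\ \text{ for all } a\ge0\Big\},$$ with the norm of $L^2(l)$. For $f\in L^2(l,\infty)$ and $\lambda\in\mathbb C$ put $$(\mathcal F_{\zeta_k}f_k)(\lambda)=\int_0^\infty e^{-i\lambda\zeta_kx}f(x\zeta_k)\,dx\qquad(k=1,2,3).$$ For $a\ge0$ let $\mathbb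 C_-(\zeta_k,a)=\{\zeta_k\eta:\operatorname{Im}\eta<a\}$ and let $H^2_-(\zeta_k,a)$ be the Hardy space of holomorphic functions $g$ on $\mathbb C_-(\zeta_k,a)$ with $\sup_{\nu<a}\int_{\mathbb R}|g(\zeta_k(x+i\nu))|^2dx<\infty$. Let $HE^2_-(\zeta_k)=\bigcap_{a\ge0}H^2_-(\zeta_k,a)$, that is, the space of entire functions whose restriction to $\mathbb C_-(\zeta_k,a)$ belongs to $H^2_-(\zeta_k,a)$ for every $a\ge0$, with the norm $\|g\|^2=\int_{\mathbb R}|g(x\zeta_k)|^2dx$, and let $HE^2_-(\zeta_1)\oplus HE^2_-(\zeta_2)\oplus HE^2_-(\zeta_3)$ have the norm $\|(g_1,g_2,g_3)\|^2=\sum_k\|g_k\|^2$. **Theorem 1.4.** (i) The sum $HE^2_-(\zeta_1)\oplus HE^2_-(\zeta_2)\oplus HE^2_-(\zeta_3)$ embeds linearly and isometrically into $L^2(L)$, where $(g_1,g_2,g_3)$ corresponds to the function equal to $g_k$ almost everywhere on $L_{\zeta_k}$, $k=1,2,3$. (ii) For every $f\in L^2(l,\infty)$, $k\in\{1,2,3\}$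 and $\lambda\in\mathbb C$, the integral defining $(\mathcal F_{\zeta_k}f_k)(\lambda)$ converges absolutely, and the Fourier transform $$f\mapsto(\mathcal F_{\zeta_1}f_1,\ \mathcal F_{\zeta_3}f_3,\ \mathcal F_{\zeta_2}f_2)$$ is a linear homeomorphism of $L^2(l,\infty)$ onto $HE^2_-(\zeta_1)\oplus HE^2_-(\zeta_2)\oplus HE^2_-(\zeta_3)$ (so $\mathcal F_{\zeta_2}f_2\in HE^2_-(\zeta_3)$ and $\mathcal F_{\zeta_3}f_3\in HE^2_-(\zeta_2)$). Moreover, the square of the norm of the transform of $f$ equals $2\pi\|f\|^2$. -/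

import Mathlib

open MeasureTheory Complex
open scoped NNReal ENNReal

noncomputable section

/-- The three cube roots of unity `ζ₁ = 1`, `ζ₂ = (-1 + i√3)/2`, `ζ₃ = (-1 - i√3)/2`;
the indices `0, 1, 2` of the code are the indices `1, 2, 3` of the text. -/
def zeta : Fin 3 → ℂ :=
  ![1, (-1 + I * (Real.sqrt 3 : ℂ)) / 2, (-1 - I * (Real.sqrt 3 : ℂ)) / 2]

theorem zeta_ne_zero (k : Fin 3) : zeta k ≠ 0 := by
  fin_cases k
  · simp [zeta]
  · intro h
    have := congrArg Complex.re h
    simp [zeta] at this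
  · intro h
    have := congrArg Complex.re h
    simp [zeta] at this

/-- Arc length on the bundle `l` of the three rays `{x ζ_k : x > 0}`. -/
def rayMeasure : Measure ℂ :=
  ∑ k : Fin 3, (volume.restrict (Set.Ioi (0 : ℝ))).map (fun x : ℝ => (x : ℂ) * zeta k)

/-- Arc length on the bundle `L` of the three lines `{x ζ_k : x ∈ ℝ}`. -/
def lineMeasure : Measure ℂ :=
  ∑ k : Fin 3, (volume : Measure ℝ).map (fun x : ℝ => (x : ℂ) * zeta k)

/-- The Hilbert space `L²(l)`, with `‖f‖² = ∑ₖ ∫₀^∞ |f(x ζ_k)|² dx`. -/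
abbrev L2Rays : Type := Lp ℂ 2 rayMeasure

/-- The Hilbert space `L²(L)`, with `‖f‖² = ∑ₖ ∫_ℝ |f(x ζ_k)|² dx`. -/
abbrev L2Lines : Type := Lp ℂ 2 lineMeasure

theorem measurable_mul_zeta (k : Fin 3) : Measurable (fun x : ℝ => (x : ℂ) * zeta k) := by
  fun_prop

theorem ae_ray_of_ae {p : ℂ → Prop} (h : ∀ᵐ z ∂rayMeasure, p z) (k : Fin 3) :
    ∀ᵐ x : ℝ ∂(volume.restrict (Set.Ioi (0 : ℝ))), p ((x : ℂ) * zeta k) := by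
  refine ae_of_ae_map (measurable_mul_zeta k).aemeasurable ?_
  rw [rayMeasure, ae_finsetSum_measure_iff] at h
  exact h k (Finset.mem_univ k)

theorem enorm_add_sq_le (u v : ℂ) : ‖u + v‖ₑ ^ 2 ≤ 2 * ‖u‖ₑ ^ 2 + 2 * ‖v‖ₑ ^ 2 := by
  have h : ‖u + v‖₊ ^ 2 ≤ 2 * ‖u‖₊ ^ 2 + 2 * ‖v‖₊ ^ 2 := by
    rw [← NNReal.coe_le_coe]
    push_cast
    have h1 := norm_add_le u v
    nlinarith [norm_nonneg (u + v), norm_nonneg u, norm_nonneg v, sq_nonneg (‖u‖ - ‖v‖)]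
  simp only [enorm_eq_nnnorm]
  exact_mod_cast h

/-- The weighted integral `∫₀^∞ e^{2ax} |f(x ζ_k)|² dx` over the `k`-th ray. -/
def weightedSq (a : ℝ) (k : Fin 3) (f : ℂ → ℂ) : ℝ≥0∞ :=
  ∫⁻ x in Set.Ioi (0 : ℝ), ENNReal.ofReal (Real.exp (2 * a * x)) * ‖f ((x : ℂ) * zeta k)‖ₑ ^ 2

theorem weightedSq_congr {a : ℝ} {k : Fin 3} {f g : ℂ → ℂ} (h : f =ᵐ[rayMeasure] g) :
    weightedSq a k f = weightedSq a k g := by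
  refine lintegral_congr_ae ?_
  filter_upwards [ae_ray_of_ae h k] with x hx
  rw [hx]

theorem weightedSq_add_le (a : ℝ) (k : Fin 3) {f g : ℂ → ℂ} (hf : StronglyMeasurable f) :
    weightedSq a k (f + g) ≤ 2 * weightedSq a k f + 2 * weightedSq a k g := by
  have hm : Measurable fun x : ℝ =>
      2 * (ENNReal.ofReal (Real.exp (2 * a * x)) * ‖f ((x : ℂ) * zeta k)‖ₑ ^ 2) := by
    have h1 : Measurable fun x : ℝ => f ((x : ℂ) * zeta k) :=
      hf.measurable.comp (measurable_mul_zeta k)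
    fun_prop
  unfold weightedSq
  rw [← lintegral_const_mul' _ _ ENNReal.ofNat_ne_top,
    ← lintegral_const_mul' _ _ ENNReal.ofNat_ne_top, ← lintegral_add_left hm]
  refine lintegral_mono fun x => ?_
  calc _ ≤ ENNReal.ofReal (Real.exp (2 * a * x)) *
        (2 * ‖f ((x : ℂ) * zeta k)‖ₑ ^ 2 + 2 * ‖g ((x : ℂ) * zeta k)‖ₑ ^ 2) := by
        gcongr
        exact enorm_add_sq_le _ _
    _ = _ := by ring

theorem weightedSq_const_mul (a : ℝ) (k : Fin 3) (c : ℂ) (f : ℂ → ℂ) :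
    weightedSq a k (c • f) = ‖c‖ₑ ^ 2 * weightedSq a k f := by
  unfold weightedSq
  rw [← lintegral_const_mul' _ _ (by simp)]
  refine lintegral_congr fun x => ?_
  simp only [Pi.smul_apply, smul_eq_mul, enorm_mul]
  ring

/-- `L²(l, ∞)`: the `f ∈ L²(l)` with `∑ₖ ∫₀^∞ e^{2ax} |f(x ζ_k)|² dx < ∞` for every `a ≥ 0`.
As a subspace of `L²(l)` it carries the norm of `L²(l)`. -/
def L2RaysInfty : Submodule ℂ L2Rays where
  carrier := {f | ∀ a : ℝ, 0 ≤ a → ∑ k : Fin 3, weightedSq a k f < ∞}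
  zero_mem' := by
    intro a _
    refine ENNReal.sum_lt_top.2 fun k _ => ?_
    rw [weightedSq_congr (Lp.coeFn_zero ℂ 2 rayMeasure)]
    simp [weightedSq]
  add_mem' := by
    intro f g hf hg a ha
    refine ENNReal.sum_lt_top.2 fun k _ => ?_
    rw [weightedSq_congr (Lp.coeFn_add f g)]
    refine (weightedSq_add_le a k (Lp.stronglyMeasurable f)).trans_lt ?_
    exact ENNReal.add_lt_top.2
      ⟨ENNReal.mul_lt_top (by simp) (ENNReal.sum_lt_top.1 (hf a ha) k (Finset.mem_univ k)),
       ENNReal.mul_lt_top (by simp) (ENNReal.sum_lt_top.1 (hg a ha) k (Finset.mem_univ k))⟩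
  smul_mem' := by
    intro c f hf a ha
    refine ENNReal.sum_lt_top.2 fun k _ => ?_
    rw [weightedSq_congr (Lp.coeFn_smul c f), weightedSq_const_mul]
    exact ENNReal.mul_lt_top (by simp)
      (ENNReal.sum_lt_top.1 (hf a ha) k (Finset.mem_univ k))

/-- The Fourier transform `(𝓕_{ζ_k} f_k)(w) = ∫₀^∞ e^{-i w ζ_k x} f(x ζ_k) dx`. -/
def rayFourier (k : Fin 3) (f : ℂ → ℂ) (w : ℂ) : ℂ :=
  ∫ x in Set.Ioi (0 : ℝ), Complex.exp (-I * w * zeta k * x) * f ((x : ℂ) * zeta k)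

/-- The half-plane `ℂ₋(ζ_k, a) = {ζ_k η : Im η < a}`. -/
def halfPlaneMinus (k : Fin 3) (a : ℝ) : Set ℂ :=
  {w | ∃ η : ℂ, η.im < a ∧ w = zeta k * η}

/-- Membership in the Hardy class `H²₋(ζ_k, a)` of the half-plane `ℂ₋(ζ_k, a)`: `g` is holomorphic
there and its square integrals along the lines `{ζ_k (x + iν) : x ∈ ℝ}`, `ν < a`, are uniformly
bounded. Only the values of `g` on the half-plane matter. -/
def IsHardyMinus (k : Fin 3) (a : ℝ) (g : ℂ → ℂ) : Prop :=
  DifferentiableOn ℂ g (halfPlaneMinus k a) ∧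
    ∃ C : ℝ≥0, ∀ ν : ℝ, ν < a → ∫⁻ x : ℝ, ‖g (zeta k * ((x : ℂ) + ν * I))‖ₑ ^ 2 ≤ C

theorem differentiable_of_isHardyMinus {k : Fin 3} {g : ℂ → ℂ}
    (h : ∀ a : ℝ, 0 ≤ a → IsHardyMinus k a g) : Differentiable ℂ g := by
  intro w
  set η : ℂ := (zeta k)⁻¹ * w with hη
  have hz := zeta_ne_zero k
  have hset : halfPlaneMinus k (|η.im| + 1) =
      {v : ℂ | ((zeta k)⁻¹ * v).im < |η.im| + 1} := by
    ext v
    constructor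
    · rintro ⟨u, hu, rfl⟩
      show ((zeta k)⁻¹ * (zeta k * u)).im < _
      rwa [inv_mul_cancel_left₀ hz]
    · intro hv
      exact ⟨(zeta k)⁻¹ * v, hv, by rw [mul_inv_cancel_left₀ hz]⟩
  refine (h (|η.im| + 1) (by positivity)).1.differentiableAt ?_
  rw [hset]
  refine IsOpen.mem_nhds (isOpen_lt (by fun_prop) continuous_const) ?_
  show η.im < |η.im| + 1
  linarith [le_abs_self η.im]

/-- `HE²₋(ζ_k) = ⋂_{a ≥ 0} H²₋(ζ_k, a)` as a vector space of functions on `ℂ`. The half-planes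
`ℂ₋(ζ_k, a)` exhaust `ℂ`, so its elements are entire functions. -/
def hardyEntireSubmodule (k : Fin 3) : Submodule ℂ (ℂ → ℂ) where
  carrier := {g | ∀ a : ℝ, 0 ≤ a → IsHardyMinus k a g}
  zero_mem' := by
    intro a _
    exact ⟨differentiableOn_const 0, 0, fun ν _ => by simp⟩
  add_mem' := by
    intro f g hf hg a ha
    obtain ⟨hf1, C, hC⟩ := hf a ha
    obtain ⟨hg1, D, hD⟩ := hg a ha
    refine ⟨hf1.add hg1, 2 * C + 2 * D, fun ν hν => ?_⟩
    have hfc := (differentiable_of_isHardyMinus hf).continuous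
    have hm : Measurable fun x : ℝ => 2 * ‖f (zeta k * ((x : ℂ) + ν * I))‖ₑ ^ 2 := by
      have : Continuous fun x : ℝ => f (zeta k * ((x : ℂ) + ν * I)) := by fun_prop
      exact (this.measurable.enorm.pow_const 2).const_mul 2
    calc ∫⁻ x : ℝ, ‖(f + g) (zeta k * ((x : ℂ) + ν * I))‖ₑ ^ 2
        ≤ ∫⁻ x : ℝ, (2 * ‖f (zeta k * ((x : ℂ) + ν * I))‖ₑ ^ 2 +
            2 * ‖g (zeta k * ((x : ℂ) + ν * I))‖ₑ ^ 2) :=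
          lintegral_mono fun x => enorm_add_sq_le _ _
      _ = 2 * (∫⁻ x : ℝ, ‖f (zeta k * ((x : ℂ) + ν * I))‖ₑ ^ 2) +
            2 * ∫⁻ x : ℝ, ‖g (zeta k * ((x : ℂ) + ν * I))‖ₑ ^ 2 := by
          rw [lintegral_add_left hm, lintegral_const_mul' _ _ ENNReal.ofNat_ne_top,
            lintegral_const_mul' _ _ ENNReal.ofNat_ne_top]
      _ ≤ 2 * C + 2 * D := by gcongr <;> [exact hC ν hν; exact hD ν hν]
      _ = ((2 * C + 2 * D : ℝ≥0) : ℝ≥0∞) := by push_cast; rfl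
  smul_mem' := by
    intro c f hf a ha
    obtain ⟨hf1, C, hC⟩ := hf a ha
    refine ⟨hf1.const_smul c, ‖c‖₊ ^ 2 * C, fun ν hν => ?_⟩
    calc ∫⁻ x : ℝ, ‖(c • f) (zeta k * ((x : ℂ) + ν * I))‖ₑ ^ 2
        = ‖c‖ₑ ^ 2 * ∫⁻ x : ℝ, ‖f (zeta k * ((x : ℂ) + ν * I))‖ₑ ^ 2 := by
          rw [← lintegral_const_mul' _ _ (by simp)]
          refine lintegral_congr fun x => ?_
          simp only [Pi.smul_apply, smul_eq_mul, enorm_mul]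
          ring
      _ ≤ ‖c‖ₑ ^ 2 * C := by gcongr; exact hC ν hν
      _ = ((‖c‖₊ ^ 2 * C : ℝ≥0) : ℝ≥0∞) := by push_cast; rfl

/-- The space `HE²₋(ζ_k)` of entire functions. It is a separate type, so that it carries the norm
of `L²(L_{ζ_k})` given below and not the topology of pointwise convergence. -/
def HardyEntire (k : Fin 3) : Type := hardyEntireSubmodule k

namespace HardyEntire

variable {k : Fin 3}

instance : AddCommGroup (HardyEntire k) := inferInstanceAs (AddCommGroup (hardyEntireSubmodule k))

instance : Module ℂ (HardyEntire k) := inferInstanceAs (Module ℂ (hardyEntireSubmodule k))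

/-- The entire function underlying an element of `HE²₋(ζ_k)`. -/
def toFun (g : HardyEntire k) : ℂ → ℂ := (hardyEntireSubmodule k).subtype g

instance : CoeFun (HardyEntire k) (fun _ => ℂ → ℂ) := ⟨toFun⟩

theorem isHardyMinus (g : HardyEntire k) {a : ℝ} (ha : 0 ≤ a) : IsHardyMinus k a g :=
  Subtype.prop (p := fun u => u ∈ hardyEntireSubmodule k) g a ha

theorem ext_toFun {f g : HardyEntire k} (h : ∀ w, f w = g w) : f = g :=
  Subtype.ext (p := fun u => u ∈ hardyEntireSubmodule k) (funext h)

theorem differentiable (g : HardyEntire k) : Differentiable ℂ g :=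
  differentiable_of_isHardyMinus fun _ ha => g.isHardyMinus ha

theorem continuous_line (g : HardyEntire k) : Continuous fun x : ℝ => g ((x : ℂ) * zeta k) := by
  have := g.differentiable.continuous
  fun_prop

theorem memLp_line (g : HardyEntire k) :
    MemLp (fun x : ℝ => g ((x : ℂ) * zeta k)) 2 volume := by
  refine ⟨g.continuous_line.aestronglyMeasurable, ?_⟩
  obtain ⟨-, C, hC⟩ := g.isHardyMinus zero_le_one
  have h0 := (hC 0 zero_lt_one).trans_lt ENNReal.coe_lt_top
  rw [eLpNorm_lt_top_iff_lintegral_rpow_enorm_lt_top (by simp) (by simp)]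
  refine lt_of_le_of_lt (le_of_eq ?_) h0
  refine lintegral_congr fun x => ?_
  simp [mul_comm]

/-- The restriction `g ↦ (x ↦ g(x ζ_k))` of `g ∈ HE²₋(ζ_k)` to the line `L_{ζ_k}`. -/
def toLine (k : Fin 3) : HardyEntire k →ₗ[ℂ] Lp ℂ 2 (volume : Measure ℝ) where
  toFun g := g.memLp_line.toLp _
  map_add' f g := MemLp.toLp_add f.memLp_line g.memLp_line
  map_smul' c f := MemLp.toLp_const_smul c f.memLp_line

theorem toLine_injective (k : Fin 3) : Function.Injective (toLine k) := by
  intro f g hfg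
  have h1 := (MemLp.toLp_eq_toLp_iff f.memLp_line g.memLp_line).1 hfg
  have h2 := (f.continuous_line.ae_eq_iff_eq volume g.continuous_line).1 h1
  have hz := zeta_ne_zero k
  have hF : AnalyticOnNhd ℂ (fun w : ℂ => f (w * zeta k)) Set.univ :=
    ((f.differentiable.comp (differentiable_id.mul_const _)).differentiableOn).analyticOnNhd
      isOpen_univ
  have hG : AnalyticOnNhd ℂ (fun w : ℂ => g (w * zeta k)) Set.univ :=
    ((g.differentiable.comp (differentiable_id.mul_const _)).differentiableOn).analyticOnNhd
      isOpen_univ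
  have ht : Filter.Tendsto (fun x : ℝ => (x : ℂ)) (nhdsWithin 0 {0}ᶜ) (nhdsWithin 0 {0}ᶜ) := by
    refine tendsto_nhdsWithin_iff.2 ⟨?_, ?_⟩
    · exact (Complex.continuous_ofReal.tendsto' 0 0 (by simp)).mono_left nhdsWithin_le_nhds
    · filter_upwards [self_mem_nhdsWithin] with x hx
      simpa using hx
  have hfr : ∃ᶠ w in nhdsWithin (0 : ℂ) {0}ᶜ, f (w * zeta k) = g (w * zeta k) :=
    ht.frequently (Filter.Frequently.of_forall fun x => congrFun h2 x)
  have := hF.eq_of_frequently_eq hG hfr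
  refine ext_toFun fun w => ?_
  have hw := congrFun this (w * (zeta k)⁻¹)
  simpa [mul_assoc, inv_mul_cancel₀ hz] using hw

/-- The norm of `HE²₋(ζ_k)` is the one of `L²(L_{ζ_k})`: `‖g‖² = ∫_ℝ |g(x ζ_k)|² dx`. -/
instance : NormedAddCommGroup (HardyEntire k) :=
  NormedAddCommGroup.induced _ _ (toLine k) (toLine_injective k)

instance : NormedSpace ℂ (HardyEntire k) := NormedSpace.induced ℂ _ _ (toLine k)

end HardyEntire

/-- The orthogonal sum `HE²₋(ζ₁) ⊕ HE²₋(ζ₂) ⊕ HE²₋(ζ₃)`, with `‖g‖² = ∑ₖ ‖g_k‖²`. -/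
abbrev HardyEntireSum : Type := PiLp 2 (fun k : Fin 3 => HardyEntire k)

end

/-! The substitution λ = ζ_k η turns the kernel of the transform along the conjugate ray into
e^{-iηx}, because ζ_k times its conjugate is 1. Each component is thus the classical problem of a
function φ on the half-line and its Fourier–Laplace transform in η, and the indices 2 and 3 get
exchanged.

On the line Im η = ν the transform is the Fourier transform of e^{νx}φ(x), so Plancherel gives 2π ∫
e^{2νx}|φ|² (`lintegral_halfLineFourier_sq`). Since the weight increases with ν, this yields the
Hardy bounds, and ν = 0 yields the factor 2π, hence injectivity and bicontinuity.

Surjectivity is a Paley–Wiener theorem (`exists_halfLineFourier_ae_eq`). Contour shift shows that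
the inverse transforms of an entire function along two horizontal lines differ by a factor e^{2πνt}
(`fourierInv_horizontal_ae_eq`). The bound that is uniform as ν → -∞ kills the inverse transform on
t < 0, and finiteness for every ν > 0 gives all exponential weights.

The embedding into L²(L) holds because distinct lines meet only at 0, a null set, so functions on
the lines can be glued. -/

noncomputable section

/-! ### The L² Fourier transform agrees with the Fourier integral on L¹ ∩ L². -/

section FourierLp

open FourierTransform SchwartzMap Filter Topology

/-- Fourier self-adjointness for an integrable function against a Schwartz function. -/
theorem integral_schwartz_fourier_smul {h : ℝ → ℂ} (h1 : Integrable h) (g : 𝓢(ℝ, ℂ)) :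
    ∫ x, (𝓕 g) x • h x = ∫ x, g x • (𝓕 h) x := by
  have := VectorFourier.integral_fourierIntegral_smul_eq_flip (L := innerₗ ℝ)
    (μ := volume) (ν := volume) Real.continuous_fourierChar continuous_inner g.integrable h1
  rw [flip_innerₗ] at this
  exact this

/-- The inverse transform is the Fourier integral for the negated pairing, so the same Fubini
identity applies. -/
theorem integral_schwartz_fourierInv_smul {h : ℝ → ℂ} (h1 : Integrable h) (g : 𝓢(ℝ, ℂ)) :
    ∫ x, (𝓕⁻ g) x • h x = ∫ x, g x • (𝓕⁻ h) x := by
  have := VectorFourier.integral_fourierIntegral_smul_eq_flip (L := -innerₗ ℝ)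
    (μ := volume) (ν := volume) Real.continuous_fourierChar (continuous_inner.neg) g.integrable h1
  rw [show (-innerₗ ℝ).flip = -innerₗ ℝ by ext; simp] at this
  rw [fourierInv_coe]
  exact this

theorem ae_eq_of_forall_schwartz {u v : ℝ → ℂ} (hu : LocallyIntegrable u)
    (hv : LocallyIntegrable v)
    (h : ∀ g : 𝓢(ℝ, ℂ), ∫ x, g x • u x = ∫ x, g x • v x) : u =ᵐ[volume] v := by
  refine ae_eq_of_integral_contDiff_smul_eq hu hv fun g hg hc => ?_
  have hg₁ : HasCompactSupport (Complex.ofRealCLM ∘ g) := hc.comp_left rfl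
  have hg₂ : ContDiff ℝ ((⊤ : ℕ∞) : WithTop ℕ∞) (Complex.ofRealCLM ∘ g) := by fun_prop
  simpa using h (hg₁.toSchwartzMap hg₂)

/-- Both sides define the same tempered distribution: the L² transform is compatible with the
distributional one, and the integral can be moved onto the test function. -/
theorem fourier_toLp_ae_eq {h : ℝ → ℂ} (h1 : Integrable h) (h2 : MemLp h 2) :
    ((𝓕 (h2.toLp h) : Lp ℂ 2 (volume : Measure ℝ)) : ℝ → ℂ) =ᵐ[volume] 𝓕 h := by
  refine ae_eq_of_forall_schwartz ((Lp.memLp _).locallyIntegrable (by norm_num))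
    (VectorFourier.fourierIntegral_continuous Real.continuous_fourierChar
      continuous_inner h1).locallyIntegrable fun g => ?_
  rw [← integral_schwartz_fourier_smul h1, ← Lp.toTemperedDistribution_apply,
    ← Lp.fourier_toTemperedDistribution_eq, TemperedDistribution.fourier_apply,
    Lp.toTemperedDistribution_apply]
  refine integral_congr_ae ?_
  filter_upwards [h2.coeFn_toLp] with x hx
  rw [hx]

theorem fourierInv_toLp_ae_eq {h : ℝ → ℂ} (h1 : Integrable h) (h2 : MemLp h 2) :
    ((𝓕⁻ (h2.toLp h) : Lp ℂ 2 (volume : Measure ℝ)) : ℝ → ℂ) =ᵐ[volume] 𝓕⁻ h := by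
  have hc : Continuous (𝓕⁻ h) := VectorFourier.fourierIntegral_continuous
      Real.continuous_fourierChar (L := -innerₗ ℝ) continuous_inner.neg h1
  refine ae_eq_of_forall_schwartz ((Lp.memLp _).locallyIntegrable (by norm_num))
    hc.locallyIntegrable fun g => ?_
  rw [← integral_schwartz_fourierInv_smul h1, ← Lp.toTemperedDistribution_apply,
    ← Lp.fourierInv_toTemperedDistribution_eq, TemperedDistribution.fourierInv_apply,
    Lp.toTemperedDistribution_apply]
  refine integral_congr_ae ?_
  filter_upwards [h2.coeFn_toLp] with x hx
  rw [hx]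

theorem eLpNorm_two_sq {α : Type*} [MeasurableSpace α] (μ : Measure α) (f : α → ℂ) :
    eLpNorm f 2 μ ^ 2 = ∫⁻ x, ‖f x‖ₑ ^ 2 ∂μ := by
  simpa using eLpNorm_nnreal_pow_eq_lintegral (f := f) (μ := μ) (p := 2) two_ne_zero

theorem memLp_two_of_lintegral_lt_top {α : Type*} [MeasurableSpace α] {μ : Measure α} {f : α → ℂ}
    (hf : AEStronglyMeasurable f μ) (h : ∫⁻ x, ‖f x‖ₑ ^ 2 ∂μ < ∞) : MemLp f 2 μ := by
  refine ⟨hf, ?_⟩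
  rw [← eLpNorm_two_sq] at h
  simpa using h

/-- **Plancherel's theorem** for the Fourier integral on `L¹ ∩ L²`. -/
theorem lintegral_enorm_fourier_sq {h : ℝ → ℂ} (h1 : Integrable h) (h2 : MemLp h 2) :
    ∫⁻ x, ‖𝓕 h x‖ₑ ^ 2 = ∫⁻ x, ‖h x‖ₑ ^ 2 := by
  rw [← eLpNorm_two_sq, ← eLpNorm_two_sq, ← eLpNorm_congr_ae (fourier_toLp_ae_eq h1 h2),
    ← eLpNorm_congr_ae h2.coeFn_toLp, ← Lp.enorm_def, ← Lp.enorm_def]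
  congr 1
  rw [enorm_eq_iff_norm_eq, Lp.norm_fourier_eq]

end FourierLp

/-! ### Shifting the contour without pointwise decay. -/

section ContourShift

open Filter Topology

/-- Contour shift: the integral of an entire function along horizontal lines is constant on a strip
in which it is uniformly integrable along these lines. -/
theorem integral_horizontal_eq {F : ℂ → ℂ} (hF : Differentiable ℂ F) {a b : ℝ} {K : ℝ≥0}
    (hK : ∀ y ∈ Set.uIcc a b, ∫⁻ x : ℝ, ‖F (x + y * I)‖ₑ ≤ K) :
    ∫ x : ℝ, F (x + a * I) = ∫ x : ℝ, F (x + b * I) := by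
  have hc : Continuous F := hF.continuous
  have hint : ∀ y ∈ Set.uIcc a b, Integrable fun x : ℝ => F (x + y * I) := fun y hy =>
    ⟨(by fun_prop : Continuous fun x : ℝ => F (x + y * I)).aestronglyMeasurable,
      (hK y hy).trans_lt ENNReal.coe_lt_top⟩
  set V : ℝ → ℂ := fun x => ∫ y : ℝ in a..b, F (x + y * I) with hV
  have hVint : Integrable V := by
    -- Tonelli: the uniform bound on each horizontal line is integrated over a bounded range of
    -- heights.
    have hp : Integrable (fun p : ℝ × ℝ => F (p.1 + p.2 * I))
        (volume.prod (volume.restrict (Set.uIoc a b))) := by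
      have hcp : Continuous fun p : ℝ × ℝ => F (p.1 + p.2 * I) := by fun_prop
      refine ⟨hcp.aestronglyMeasurable, ?_⟩
      rw [hasFiniteIntegral_def, lintegral_prod_symm' _ hcp.measurable.enorm]
      calc _ ≤ ∫⁻ y in Set.uIoc a b, (K : ℝ≥0∞) :=
            setLIntegral_mono measurable_const fun y hy => hK y (Set.uIoc_subset_uIcc hy)
        _ < ∞ := by
            rw [lintegral_const, Measure.restrict_apply_univ, Set.uIoc, Real.volume_Ioc]
            exact ENNReal.mul_lt_top ENNReal.coe_lt_top ENNReal.ofReal_lt_top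
    have := hp.integral_prod_left
    simp only [hV, intervalIntegral.intervalIntegral_eq_integral_uIoc]
    exact this.smul _
  have hW : Integrable fun R : ℝ => V R - V (-R) := hVint.sub hVint.comp_neg
  have hrect : ∀ R : ℝ, I • (V R - V (-R)) =
      (∫ x : ℝ in (-R)..R, F (x + b * I)) - ∫ x : ℝ in (-R)..R, F (x + a * I) := by
    intro R
    have := Complex.integral_boundary_rect_eq_zero_of_differentiableOn F (-R + a * I) (R + b * I)
      hF.differentiableOn
    simp at this
    simp only [hV, smul_eq_mul]
    push_cast
    linear_combination this
  have hlim : Tendsto (fun R : ℝ => I • (V R - V (-R))) atTop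
      (𝓝 ((∫ x : ℝ, F (x + b * I)) - ∫ x : ℝ, F (x + a * I))) := by
    simp only [hrect]
    exact (intervalIntegral_tendsto_integral (hint b Set.right_mem_uIcc)
      tendsto_neg_atTop_atBot tendsto_id).sub
      (intervalIntegral_tendsto_integral (hint a Set.left_mem_uIcc)
      tendsto_neg_atTop_atBot tendsto_id)
  -- The vertical sides are integrable in R and, by Cauchy's theorem, converge as R → ∞; an
  -- integrable function can only have the limit 0.
  have := IntegrableAtFilter.eq_zero_of_tendsto (μ := volume)
    ((hW.smul I).integrableAtFilter atTop) (fun s hs => ?_) hlim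
  · exact (sub_eq_zero.1 this).symm
  · obtain ⟨r, hr⟩ := mem_atTop_sets.1 hs
    exact top_unique ((Real.volume_Ici (a := r)).symm.le.trans (measure_mono hr))

end ContourShift

/-! ### Inverse transforms along different horizontal lines. -/

section EntireFourier

open FourierTransform Filter Topology

variable {H : ℂ → ℂ}

theorem memLp_horizontal (hH : Differentiable ℂ H)
    (hb : ∀ a : ℝ, ∃ C : ℝ≥0, ∀ ν < a, ∫⁻ x : ℝ, ‖H (x + ν * I)‖ₑ ^ 2 ≤ C) (ν : ℝ) :
    MemLp (fun x : ℝ => H (x + ν * I)) 2 := by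
  obtain ⟨C, hC⟩ := hb (ν + 1)
  have hc := hH.continuous
  exact memLp_two_of_lintegral_lt_top
    (by fun_prop : Continuous fun x : ℝ => H (x + ν * I)).aestronglyMeasurable
    ((hC ν (by linarith)).trans_lt ENNReal.coe_lt_top)

theorem norm_exp_neg_mul_sq (ε x ν : ℝ) :
    ‖cexp (-ε * (x + ν * I) ^ 2)‖ = Real.exp (ε * ν ^ 2) * Real.exp (-ε * x ^ 2) := by
  rw [Complex.norm_exp, ← Real.exp_add]
  congr 1
  simp [pow_two]
  ring

theorem memLp_exp_neg_mul_sq {ε : ℝ} (hε : 0 < ε) (ν : ℝ) :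
    MemLp (fun x : ℝ => cexp (-ε * (x + ν * I) ^ 2)) 2 := by
  have h : MemLp (fun x : ℝ => Real.exp (-ε * x ^ 2)) 2 := by
    rw [memLp_two_iff_integrable_sq (by fun_prop)]
    refine (integrable_exp_neg_mul_sq (b := 2 * ε) (by positivity)).congr (ae_of_all _ fun x => ?_)
    simp only
    rw [← Real.exp_nat_mul]
    push_cast
    ring_nf
  refine (h.const_mul (Real.exp (ε * ν ^ 2))).of_le (by fun_prop) (ae_of_all _ fun x => ?_)
  rw [norm_exp_neg_mul_sq, Real.norm_of_nonneg (by positivity)]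

theorem memLp_gaussian_mul (hH : Differentiable ℂ H)
    (hb : ∀ a : ℝ, ∃ C : ℝ≥0, ∀ ν < a, ∫⁻ x : ℝ, ‖H (x + ν * I)‖ₑ ^ 2 ≤ C) {ε : ℝ} (hε : 0 < ε)
    (ν : ℝ) : MemLp (fun x : ℝ => cexp (-ε * (x + ν * I) ^ 2) * H (x + ν * I)) 2 := by
  have hc := hH.continuous
  refine ((memLp_horizontal hH hb ν).const_mul (Real.exp (ε * ν ^ 2) : ℂ)).of_le
    (by fun_prop : Continuous fun x : ℝ =>
      cexp (-ε * (x + ν * I) ^ 2) * H (x + ν * I)).aestronglyMeasurable (ae_of_all _ fun x => ?_)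
  rw [norm_mul, norm_mul, norm_exp_neg_mul_sq, Complex.norm_real,
    Real.norm_of_nonneg (Real.exp_nonneg _)]
  gcongr
  refine mul_le_of_le_one_right (Real.exp_nonneg _) (Real.exp_le_one_iff.2 ?_)
  nlinarith [sq_nonneg x]

/-- Cauchy–Schwarz. Square integrability alone does not make the inverse transform an integral; the
Gaussian factor does, and it is entire, so contours can still be shifted. -/
theorem integrable_gaussian_mul (hH : Differentiable ℂ H)
    (hb : ∀ a : ℝ, ∃ C : ℝ≥0, ∀ ν < a, ∫⁻ x : ℝ, ‖H (x + ν * I)‖ₑ ^ 2 ≤ C) {ε : ℝ} (hε : 0 < ε)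
    (ν : ℝ) : Integrable (fun x : ℝ => cexp (-ε * (x + ν * I) ^ 2) * H (x + ν * I)) :=
  (memLp_exp_neg_mul_sq hε ν).integrable_mul (memLp_horizontal hH hb ν)

theorem enorm_mul_le_sq_add_sq (u v : ℂ) : ‖u * v‖ₑ ≤ ‖u‖ₑ ^ 2 + ‖v‖ₑ ^ 2 := by
  have h : ‖u * v‖₊ ≤ ‖u‖₊ ^ 2 + ‖v‖₊ ^ 2 := by
    rw [← NNReal.coe_le_coe]
    push_cast
    rw [norm_mul]
    nlinarith [norm_nonneg u, norm_nonneg v, sq_nonneg (‖u‖ - ‖v‖)]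
  simp only [enorm_eq_nnnorm]
  exact_mod_cast h

/-- Up to the factor e^{2πνt}, both sides integrate the one entire function e^{2πitz} e^{-εz²} H(z),
along the heights ν and 0. -/
theorem fourierInv_gaussian_mul (hH : Differentiable ℂ H)
    (hb : ∀ a : ℝ, ∃ C : ℝ≥0, ∀ ν < a, ∫⁻ x : ℝ, ‖H (x + ν * I)‖ₑ ^ 2 ≤ C) {ε : ℝ} (hε : 0 < ε)
    (ν t : ℝ) :
    𝓕⁻ (fun x : ℝ => cexp (-ε * (x + ν * I) ^ 2) * H (x + ν * I)) t =
      cexp (2 * Real.pi * ν * t) *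
        𝓕⁻ (fun x : ℝ => cexp (-ε * (x + (0 : ℝ) * I) ^ 2) * H (x + (0 : ℝ) * I)) t := by
  set F : ℂ → ℂ := fun z => (cexp (2 * Real.pi * I * t * z) * cexp (-ε * z ^ 2)) * H z with hFdef
  have hF : Differentiable ℂ F := by fun_prop
  have key : ∀ y : ℝ, 𝓕⁻ (fun x : ℝ => cexp (-ε * (x + y * I) ^ 2) * H (x + y * I)) t =
      cexp (2 * Real.pi * y * t) * ∫ x : ℝ, F (x + y * I) := by
    intro y
    rw [Real.fourierInv_eq', ← integral_const_mul]
    refine integral_congr_ae (ae_of_all _ fun x => ?_)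
    simp only [hFdef, smul_eq_mul, ← mul_assoc, ← Complex.exp_add]
    congr 2
    simp
    linear_combination (-2 * Real.pi * y * t : ℂ) * I_sq
  obtain ⟨C, hC⟩ := hb (|ν| + 1)
  have hG := (memLp_exp_neg_mul_sq hε 0)
  -- `M` bounds the parts of both exponentials that depend on the height, for heights up to |ν|; the
  -- factor e^{-εx²} remains.
  set M : ℝ := Real.exp (2 * Real.pi * |t| * |ν| + ε * ν ^ 2)
  set K : ℝ≥0∞ := (∫⁻ x : ℝ, ‖(M : ℂ) * cexp (-ε * (x + (0 : ℝ) * I) ^ 2)‖ₑ ^ 2) + C with hKdef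
  have hK : K < ∞ := by
    refine ENNReal.add_lt_top.2 ⟨?_, ENNReal.coe_lt_top⟩
    rw [← eLpNorm_two_sq]
    exact ENNReal.pow_lt_top (hG.const_mul (M : ℂ)).2
  lift K to ℝ≥0 using hK.ne with K'
  have hbound : ∀ y ∈ Set.uIcc 0 ν, ∫⁻ x : ℝ, ‖F (x + y * I)‖ₑ ≤ K' := by
    intro y hy
    have hy' : |y| ≤ |ν| := by simpa using Set.abs_sub_left_of_mem_uIcc hy
    rw [hKdef]
    have hc := hH.continuous
    calc _ ≤ ∫⁻ x : ℝ, (‖(M : ℂ) * cexp (-ε * (x + (0 : ℝ) * I) ^ 2)‖ₑ ^ 2 +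
          ‖H (x + y * I)‖ₑ ^ 2) := by
          refine lintegral_mono fun x => (enorm_mul_le_sq_add_sq _ _).trans ?_
          gcongr 2
          rw [enorm_le_iff_norm_le, norm_mul, norm_mul, norm_exp_neg_mul_sq, norm_exp_neg_mul_sq,
            Complex.norm_real, Real.norm_of_nonneg (Real.exp_nonneg _), Complex.norm_exp]
          simp only [← Real.exp_add]
          rw [Real.exp_le_exp]
          have h1 : y ^ 2 ≤ ν ^ 2 := sq_le_sq.2 hy'
          have h2 : -(t * y) ≤ |t| * |ν| := (neg_le_abs _).trans (by rw [abs_mul]; gcongr)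
          have h3 := mul_le_mul_of_nonneg_left h2 (mul_pos two_pos Real.pi_pos).le
          have h4 := mul_le_mul_of_nonneg_left h1 hε.le
          simp
          linarith
      _ ≤ _ := by
          rw [lintegral_add_left (by fun_prop)]
          gcongr
          exact hC y (by linarith [le_abs_self y])
  rw [key, key, ← integral_horizontal_eq hF hbound]
  simp

/-- The Gaussian regularisation tends to the identity in `L²` on horizontal lines. -/
theorem tendsto_gaussian_mul_toLp (hH : Differentiable ℂ H)
    (hb : ∀ a : ℝ, ∃ C : ℝ≥0, ∀ ν < a, ∫⁻ x : ℝ, ‖H (x + ν * I)‖ₑ ^ 2 ≤ C) (ν : ℝ) {ε : ℕ → ℝ}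
    (hε : ∀ n, 0 < ε n) (hε1 : ∀ n, ε n ≤ 1) (hlim : Tendsto ε atTop (𝓝 0)) :
    Tendsto (fun n => (memLp_gaussian_mul hH hb (hε n) ν).toLp _) atTop
      (𝓝 ((memLp_horizontal hH hb ν).toLp _)) := by
  have hc := hH.continuous
  rw [Lp.tendsto_Lp_iff_tendsto_eLpNorm'']
  have hsq : Tendsto (fun n => ∫⁻ x : ℝ, ‖cexp (-ε n * (x + ν * I) ^ 2) * H (x + ν * I) -
      H (x + ν * I)‖ₑ ^ 2) atTop (𝓝 (∫⁻ x : ℝ, 0)) := by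
    -- On this line |e^{-εz²} - 1| ≤ e^{ν²} + 1, uniformly in n because ε ≤ 1.
    refine tendsto_lintegral_of_dominated_convergence
      (fun x => ‖((Real.exp (ν ^ 2) + 1 : ℝ) : ℂ) * H (x + ν * I)‖ₑ ^ 2) (fun n => by fun_prop)
      (fun n => ae_of_all _ fun x => ?_) ?_ (ae_of_all _ fun x => ?_)
    · refine pow_le_pow_left' ?_ 2
      rw [enorm_le_iff_norm_le, ← sub_one_mul, norm_mul, norm_mul, Complex.norm_real,
        Real.norm_of_nonneg (by positivity)]
      gcongr
      refine (norm_sub_le _ _).trans ?_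
      rw [norm_one, norm_exp_neg_mul_sq]
      gcongr
      rw [← Real.exp_add]
      gcongr
      nlinarith [hε n, hε1 n, sq_nonneg x, sq_nonneg ν, mul_nonneg (hε n).le (sq_nonneg x)]
    · rw [← eLpNorm_two_sq]
      exact (ENNReal.pow_lt_top ((memLp_horizontal hH hb ν).const_mul _).2).ne
    · have h1 : Tendsto (fun n => cexp (-ε n * (x + ν * I) ^ 2) * H (x + ν * I) -
          H (x + ν * I)) atTop (𝓝 (cexp (-(0 : ℝ) * (x + ν * I) ^ 2) * H (x + ν * I) -
          H (x + ν * I))) := by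
        have : Continuous fun e : ℝ => cexp (-e * (x + ν * I) ^ 2) * H (x + ν * I) -
          H (x + ν * I) := by fun_prop
        exact (this.tendsto 0).comp hlim
      have h2 := (ENNReal.continuous_pow 2).tendsto _ |>.comp h1.enorm
      simpa [Function.comp_def] using h2
  have h3 := (ENNReal.continuous_rpow_const (y := 1 / 2)).tendsto _ |>.comp hsq
  refine Tendsto.congr (fun n => ?_) (h3.trans (by simp))
  simp only [Function.comp_apply]
  rw [← eLpNorm_two_sq, ← ENNReal.rpow_natCast_mul]
  norm_num
  rfl

/-- The inverse Fourier transforms of an entire function along two horizontal lines differ by an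
exponential weight. -/
theorem fourierInv_horizontal_ae_eq (hH : Differentiable ℂ H)
    (hb : ∀ a : ℝ, ∃ C : ℝ≥0, ∀ ν < a, ∫⁻ x : ℝ, ‖H (x + ν * I)‖ₑ ^ 2 ≤ C) (ν : ℝ) :
    ((𝓕⁻ ((memLp_horizontal hH hb ν).toLp _) : Lp ℂ 2 (volume : Measure ℝ)) : ℝ → ℂ)
      =ᵐ[volume] fun t : ℝ => cexp (2 * Real.pi * ν * t) *
        (𝓕⁻ ((memLp_horizontal hH hb 0).toLp _) : Lp ℂ 2 (volume : Measure ℝ)) t := by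
  set ε : ℕ → ℝ := fun n => 1 / ((n : ℝ) + 1) with hεdef
  have hε : ∀ n, 0 < ε n := fun n => by positivity
  have hε1 : ∀ n, ε n ≤ 1 := fun n => by
    rw [hεdef]; exact (div_le_one (by positivity)).2 (by linarith [n.cast_nonneg (α := ℝ)])
  have hlim : Tendsto ε atTop (𝓝 0) := tendsto_one_div_add_atTop_nhds_zero_nat
  have hcont : Continuous fun u : Lp ℂ 2 (volume : Measure ℝ) => 𝓕⁻ u :=
    (Lp.fourierTransformₗᵢ ℝ ℂ).symm.continuous
  have hL : ∀ y : ℝ, Tendsto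
      (fun n => 𝓕⁻ ((memLp_gaussian_mul hH hb (hε n) y).toLp _)) atTop
      (𝓝 (𝓕⁻ ((memLp_horizontal hH hb y).toLp _))) := fun y =>
    (hcont.tendsto _).comp (tendsto_gaussian_mul_toLp hH hb y hε hε1 hlim)
  -- L² convergence gives a.e. convergence only along subsequences; the second is extracted from the
  -- first so that one sequence serves both lines.
  obtain ⟨n₁, hn₁, h₁⟩ := (tendstoInMeasure_of_tendsto_Lp (hL ν)).exists_seq_tendsto_ae
  obtain ⟨n₂, hn₂, h₂⟩ := (tendstoInMeasure_of_tendsto_Lp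
    ((hL 0).comp hn₁.tendsto_atTop)).exists_seq_tendsto_ae
  have hae : ∀ y : ℝ, ∀ᵐ t : ℝ, ∀ n,
      (𝓕⁻ ((memLp_gaussian_mul hH hb (hε n) y).toLp _) : Lp ℂ 2 (volume : Measure ℝ)) t =
      𝓕⁻ (fun x : ℝ => cexp (-ε n * (x + y * I) ^ 2) * H (x + y * I)) t := fun y =>
    ae_all_iff.2 fun n => fourierInv_toLp_ae_eq (integrable_gaussian_mul hH hb (hε n) y)
      (memLp_gaussian_mul hH hb (hε n) y)
  filter_upwards [h₁, h₂, hae ν, hae 0] with t ht₁ ht₂ ha ha0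
  refine tendsto_nhds_unique (ht₁.comp hn₂.tendsto_atTop) ?_
  refine (ht₂.const_mul (cexp (2 * Real.pi * ν * t))).congr fun n => ?_
  simp only [Function.comp_apply]
  rw [ha, ha0, ← fourierInv_gaussian_mul hH hb (hε _) ν t]

end EntireFourier

/-! ### Plancherel and Paley–Wiener on the half-line. -/

section HalfLine

open FourierTransform Filter Topology

/-- The Fourier–Laplace transform `∫₀^∞ e^{-iηx} φ(x) dx`. -/
def halfLineFourier (φ : ℝ → ℂ) (η : ℂ) : ℂ :=
  ∫ x in Set.Ioi (0 : ℝ), cexp (-I * η * x) * φ x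

/-- The weighted integral `∫₀^∞ e^{2ax} |φ(x)|² dx`. -/
def halfLineSq (a : ℝ) (φ : ℝ → ℂ) : ℝ≥0∞ :=
  ∫⁻ x in Set.Ioi (0 : ℝ), ENNReal.ofReal (Real.exp (2 * a * x)) * ‖φ x‖ₑ ^ 2

theorem enorm_exp_mul_sq (a x : ℝ) (u : ℂ) :
    ‖(Real.exp (a * x) : ℂ) * u‖ₑ ^ 2 = ENNReal.ofReal (Real.exp (2 * a * x)) * ‖u‖ₑ ^ 2 := by
  rw [enorm_mul, mul_pow, ← ofReal_norm, Complex.norm_real,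
    Real.norm_of_nonneg (Real.exp_nonneg _), ← ENNReal.ofReal_pow (Real.exp_nonneg _),
    ← Real.exp_nat_mul]
  push_cast
  ring_nf

variable {φ : ℝ → ℂ}

theorem halfLineSq_mono {a b : ℝ} (h : a ≤ b) : halfLineSq a φ ≤ halfLineSq b φ := by
  refine setLIntegral_mono_ae' measurableSet_Ioi (ae_of_all _ fun x hx => ?_)
  have : (0 : ℝ) < x := hx
  gcongr

theorem memLp_exp_mul (hφ : AEStronglyMeasurable φ (volume.restrict (Set.Ioi (0 : ℝ))))
    (hw : ∀ a : ℝ, 0 ≤ a → halfLineSq a φ < ∞) (a : ℝ) :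
    MemLp (fun x : ℝ => (Real.exp (a * x) : ℂ) * φ x) 2 (volume.restrict (Set.Ioi 0)) := by
  refine ⟨(by fun_prop : Continuous fun x : ℝ => (Real.exp (a * x) : ℂ)).aestronglyMeasurable.mul
    hφ, ?_⟩
  have : eLpNorm (fun x : ℝ => (Real.exp (a * x) : ℂ) * φ x) 2 (volume.restrict (Set.Ioi 0)) ^ 2
      < ∞ := by
    rw [eLpNorm_two_sq]
    simp only [enorm_exp_mul_sq]
    exact (halfLineSq_mono (le_abs_self a)).trans_lt (hw _ (abs_nonneg a))
  simpa using this

/-- Cauchy–Schwarz after splitting e^{ax}φ as e^{-x} times e^{(a+1)x}φ: all weights are available,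
so one unit can be spent. -/
theorem integrable_exp_mul (hφ : AEStronglyMeasurable φ (volume.restrict (Set.Ioi (0 : ℝ))))
    (hw : ∀ a : ℝ, 0 ≤ a → halfLineSq a φ < ∞) (a : ℝ) :
    IntegrableOn (fun x : ℝ => (Real.exp (a * x) : ℂ) * φ x) (Set.Ioi 0) := by
  have h1 : MemLp (fun x : ℝ => Real.exp (-x)) 2 (volume.restrict (Set.Ioi 0)) := by
    refine (memLp_two_iff_integrable_sq (by fun_prop)).2 ?_
    refine (exp_neg_integrableOn_Ioi 0 (b := 2) two_pos).congr (ae_of_all _ fun x => ?_)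
    simp only
    rw [← Real.exp_nat_mul]
    push_cast
    ring_nf
  refine (h1.ofReal.integrable_mul (memLp_exp_mul hφ hw (a + 1))).congr (ae_of_all _ fun x => ?_)
  change (Real.exp (-x) : ℂ) * ((Real.exp ((a + 1) * x) : ℂ) * φ x) = _
  rw [← mul_assoc, ← Complex.ofReal_mul, ← Real.exp_add]
  ring_nf

theorem norm_exp_I_mul (η : ℂ) (x : ℝ) : ‖cexp (-I * η * x)‖ = Real.exp (η.im * x) := by
  rw [Complex.norm_exp]
  simp

theorem integrableOn_exp_I_mul (hφ : AEStronglyMeasurable φ (volume.restrict (Set.Ioi (0 : ℝ))))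
    (hw : ∀ a : ℝ, 0 ≤ a → halfLineSq a φ < ∞) (η : ℂ) :
    IntegrableOn (fun x : ℝ => cexp (-I * η * x) * φ x) (Set.Ioi 0) := by
  refine Integrable.mono (integrable_exp_mul hφ hw η.im)
    ((by fun_prop : Continuous fun x : ℝ => cexp (-I * η * x)).aestronglyMeasurable.mul hφ)
    (ae_of_all _ fun x => ?_)
  rw [norm_mul, norm_mul, norm_exp_I_mul, Complex.norm_real,
    Real.norm_of_nonneg (Real.exp_nonneg _)]

theorem differentiable_halfLineFourier
    (hφ : AEStronglyMeasurable φ (volume.restrict (Set.Ioi (0 : ℝ))))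
    (hw : ∀ a : ℝ, 0 ≤ a → halfLineSq a φ < ∞) : Differentiable ℂ (halfLineFourier φ) := by
  intro η
  have hm : ∀ u : ℂ, AEStronglyMeasurable (fun x : ℝ => cexp (-I * u * x) * φ x)
      (volume.restrict (Set.Ioi 0)) := fun u =>
    (by fun_prop : Continuous fun x : ℝ => cexp (-I * u * x)).aestronglyMeasurable.mul hφ
  have := hasDerivAt_integral_of_dominated_loc_of_deriv_le
    (μ := volume.restrict (Set.Ioi (0 : ℝ))) (F := fun u (x : ℝ) => cexp (-I * u * x) * φ x)
    (F' := fun u (x : ℝ) => (-I * x) * (cexp (-I * u * x) * φ x))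
    -- One unit in the exponent covers the radius of the ball, the other absorbs the factor x ≤ e^x.
    (bound := fun x => ‖(Real.exp ((η.im + 2) * x) : ℂ) * φ x‖)
    (Metric.ball_mem_nhds η one_pos) (Eventually.of_forall hm) (integrableOn_exp_I_mul hφ hw η)
    ((by fun_prop : Continuous fun x : ℝ => -I * (x : ℂ)).aestronglyMeasurable.mul (hm η))
    ?_ (integrable_exp_mul hφ hw _).norm (ae_of_all _ fun x u _ => ?_)
  · exact this.2.differentiableAt
  · refine (ae_restrict_iff' measurableSet_Ioi).2 (ae_of_all _ fun x hx u hu => ?_)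
    have hx : (0 : ℝ) < x := hx
    rw [norm_mul, norm_mul (cexp _), norm_exp_I_mul, norm_mul _ (φ x), Complex.norm_real,
      Real.norm_of_nonneg (Real.exp_nonneg _), ← mul_assoc]
    gcongr
    have him : u.im ≤ η.im + 1 := by
      have h1 := (Complex.abs_im_le_norm (u - η)).trans (mem_ball_iff_norm.1 hu).le
      rw [Complex.sub_im] at h1
      linarith [le_abs_self (u.im - η.im)]
    calc ‖-I * (x : ℂ)‖ * Real.exp (u.im * x) ≤ Real.exp x * Real.exp ((η.im + 1) * x) := by
          gcongr
          simp only [norm_mul, norm_neg, norm_I, one_mul, Complex.norm_real, Real.norm_of_nonneg hx.le]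
          linarith [Real.add_one_le_exp x]
      _ = _ := by rw [← Real.exp_add]; ring_nf
  · have h1 : HasDerivAt (fun u : ℂ => -I * u * x) (-I * x) u := by
      simpa using ((hasDerivAt_id u).const_mul (-I)).mul_const (x : ℂ)
    convert! (h1.cexp.mul_const (φ x)) using 1
    ring

theorem lintegral_eq_mul_lintegral_comp {c : ℝ} (hc : 0 < c) {u : ℝ → ℝ≥0∞} (hu : Measurable u) :
    ∫⁻ x, u x = ENNReal.ofReal c * ∫⁻ x, u (c * x) := by
  conv_lhs => rw [← Real.smul_map_volume_mul_left hc.ne']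
  rw [lintegral_smul_measure, lintegral_map hu (by fun_prop), abs_of_pos hc, smul_eq_mul]

theorem fourier_indicator_eq_halfLineFourier (ν ξ : ℝ) :
    𝓕 ((Set.Ioi 0).indicator fun x : ℝ => (Real.exp (ν * x) : ℂ) * φ x) ξ =
      halfLineFourier φ ((2 * Real.pi * ξ : ℝ) + ν * I) := by
  rw [Real.fourier_real_eq_integral_exp_smul, halfLineFourier, ← integral_indicator measurableSet_Ioi]
  refine integral_congr_ae (ae_of_all _ fun x => ?_)
  simp only [Set.indicator_apply]
  split_ifs with h
  · rw [smul_eq_mul, ← mul_assoc, Complex.ofReal_exp, ← Complex.exp_add]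
    congr 2
    push_cast
    linear_combination (ν * x : ℂ) * I_sq
  · simp

/-- Plancherel for e^{νx}φ(x) extended by zero; 2π is the Jacobian between the kernels e^{-iηx} and
e^{-2πiξx}. -/
theorem lintegral_halfLineFourier_sq
    (hφ : AEStronglyMeasurable φ (volume.restrict (Set.Ioi (0 : ℝ))))
    (hw : ∀ a : ℝ, 0 ≤ a → halfLineSq a φ < ∞) (ν : ℝ) :
    ∫⁻ x : ℝ, ‖halfLineFourier φ (x + ν * I)‖ₑ ^ 2 =
      ENNReal.ofReal (2 * Real.pi) * halfLineSq ν φ := by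
  have hc := (differentiable_halfLineFourier hφ hw).continuous
  rw [lintegral_eq_mul_lintegral_comp (c := 2 * Real.pi) (by positivity)
    ((by fun_prop : Continuous fun x : ℝ => halfLineFourier φ (x + ν * I)).measurable.enorm.pow_const 2)]
  simp only [← fourier_indicator_eq_halfLineFourier]
  rw [lintegral_enorm_fourier_sq
    ((integrable_indicator_iff measurableSet_Ioi).2 (integrable_exp_mul hφ hw ν))
    ((memLp_indicator_iff_restrict measurableSet_Ioi).2 (memLp_exp_mul hφ hw ν)), halfLineSq,
    ← lintegral_indicator measurableSet_Ioi]
  congr 2 with x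
  by_cases h : x ∈ Set.Ioi (0 : ℝ)
  · simp only [Set.indicator_of_mem h, enorm_exp_mul_sq]
  · simp [Set.indicator_of_notMem h]

/-- A function with bounded exponential moments `∫ e^{-2nt} |f|²` vanishes on the negative axis. -/
theorem ae_eq_zero_of_lintegral_exp_le {f : ℝ → ℂ} (hf : AEStronglyMeasurable f) {C : ℝ≥0}
    (h : ∀ n : ℕ, ∫⁻ t, ENNReal.ofReal (Real.exp (2 * (-n) * t)) * ‖f t‖ₑ ^ 2 ≤ C) :
    ∀ᵐ t : ℝ, t < 0 → f t = 0 := by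
  -- Left of -δ the weight is at least e^{2nδ}, which is unbounded in n, so the mass there must
  -- vanish. Countably many δ exhaust the negative axis.
  have hδ : ∀ m : ℕ, ∀ᵐ t : ℝ, t < -(1 / ((m : ℝ) + 1)) → f t = 0 := by
    intro m
    set δ : ℝ := 1 / ((m : ℝ) + 1) with hδdef
    have hδ0 : 0 < δ := by positivity
    set J : ℝ≥0∞ := ∫⁻ t in Set.Iio (-δ), ‖f t‖ₑ ^ 2 with hJ
    have hle : ∀ n : ℕ, ENNReal.ofReal (Real.exp (2 * n * δ)) * J ≤ C := fun n => by
      refine le_trans ?_ (h n)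
      rw [hJ, ← lintegral_const_mul' _ _ ENNReal.ofReal_ne_top]
      refine le_trans (setLIntegral_mono_ae' measurableSet_Iio (ae_of_all _ fun t ht => ?_))
        (setLIntegral_le_lintegral _ _)
      have : t < -δ := ht
      refine mul_le_mul_left (ENNReal.ofReal_le_ofReal (Real.exp_le_exp.2 ?_)) _
      nlinarith [n.cast_nonneg (α := ℝ)]
    have hJ0 : J = 0 := by
      by_contra hne
      have hlim : Tendsto (fun n : ℕ => ENNReal.ofReal (Real.exp (2 * n * δ)) * J) atTop (𝓝 ∞) := by
        have h1 : Tendsto (fun n : ℕ => Real.exp (2 * n * δ)) atTop atTop :=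
          Real.tendsto_exp_atTop.comp
            ((tendsto_natCast_atTop_atTop.const_mul_atTop two_pos).atTop_mul_const hδ0)
        have h2 := ENNReal.Tendsto.mul_const (b := J) (ENNReal.tendsto_ofReal_atTop.comp h1)
          (Or.inl ENNReal.top_ne_zero)
        rwa [ENNReal.top_mul hne] at h2
      exact absurd (le_of_tendsto' hlim hle) (by simp)
    rw [hJ, lintegral_eq_zero_iff' (by fun_prop)] at hJ0
    filter_upwards [(ae_restrict_iff' measurableSet_Iio).1 hJ0] with t ht htδ
    simpa using ht htδ
  filter_upwards [ae_all_iff.2 hδ] with t ht ht0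
  obtain ⟨m, hm⟩ := exists_nat_one_div_lt (neg_pos.2 ht0)
  exact ht m (by linarith)

/-- **Paley–Wiener theorem** for entire functions that are Hardy class in every lower half-plane. -/
theorem exists_halfLineFourier_ae_eq {G : ℂ → ℂ} (hG : Differentiable ℂ G)
    (hb : ∀ a : ℝ, 0 ≤ a → ∃ C : ℝ≥0, ∀ ν < a, ∫⁻ x : ℝ, ‖G (x + ν * I)‖ₑ ^ 2 ≤ C) :
    ∃ φ : ℝ → ℂ, StronglyMeasurable φ ∧ (∀ a : ℝ, 0 ≤ a → halfLineSq a φ < ∞) ∧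
      ∀ᵐ x : ℝ, halfLineFourier φ x = G x := by
  have hGc := hG.continuous
  -- The rescaling by 2π passes to the kernel e^{-2πiξx}.
  set H : ℂ → ℂ := fun z => G (2 * Real.pi * z) with hHdef
  have hH : Differentiable ℂ H := by fun_prop
  have hline : ∀ ν : ℝ, ∫⁻ x : ℝ, ‖G (x + (2 * Real.pi * ν : ℝ) * I)‖ₑ ^ 2 =
      ENNReal.ofReal (2 * Real.pi) * ∫⁻ x : ℝ, ‖H (x + ν * I)‖ₑ ^ 2 := fun ν => by
    rw [lintegral_eq_mul_lintegral_comp (c := 2 * Real.pi) (by positivity)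
      ((by fun_prop : Continuous fun x : ℝ => G (x + (2 * Real.pi * ν : ℝ) * I)).measurable.enorm.pow_const 2)]
    congr 2 with x
    simp only [hHdef]
    push_cast
    ring_nf
  have hHb : ∀ a : ℝ, ∃ C : ℝ≥0, ∀ ν < a, ∫⁻ x : ℝ, ‖H (x + ν * I)‖ₑ ^ 2 ≤ C := fun a => by
    obtain ⟨C, hC⟩ := hb (2 * Real.pi * |a|) (by positivity)
    refine ⟨C, fun ν hν => le_trans ?_ (hC (2 * Real.pi * ν) ?_)⟩
    · rw [hline]
      refine le_mul_of_one_le_left (by simp) ?_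
      rw [ENNReal.one_le_ofReal]
      linarith [Real.pi_gt_three]
    · have := hν.trans_le (le_abs_self a)
      gcongr
  set f : Lp ℂ 2 (volume : Measure ℝ) := 𝓕⁻ ((memLp_horizontal hH hHb 0).toLp _) with hf
  -- Plancherel on the line at height ν, whose inverse transform is e^{2πνt} f(t).
  have hwt : ∀ ν : ℝ, ∫⁻ t, ENNReal.ofReal (Real.exp (2 * (2 * Real.pi * ν) * t)) * ‖f t‖ₑ ^ 2 =
      ∫⁻ x : ℝ, ‖H (x + ν * I)‖ₑ ^ 2 := fun ν => by
    rw [← eLpNorm_two_sq, ← eLpNorm_congr_ae (memLp_horizontal hH hHb ν).coeFn_toLp, ← Lp.enorm_def,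
      ← enorm_eq_iff_norm_eq.2 ((Lp.fourierTransformₗᵢ ℝ ℂ).symm.norm_map
        ((memLp_horizontal hH hHb ν).toLp _)), Lp.enorm_def, eLpNorm_two_sq]
    refine lintegral_congr_ae ?_
    filter_upwards [fourierInv_horizontal_ae_eq hH hHb ν] with t ht
    rw [← enorm_exp_mul_sq, hf]
    refine congrArg (fun z : ℂ => ‖z‖ₑ ^ 2) ?_
    refine Eq.trans ?_ ht.symm
    push_cast
    rfl
  have hfm := Lp.stronglyMeasurable f
  have hf0 : ∀ᵐ t : ℝ, t < 0 → f t = 0 := by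
    obtain ⟨C, hC⟩ := hHb 1
    refine ae_eq_zero_of_lintegral_exp_le hfm.aestronglyMeasurable (C := C) fun n => ?_
    -- These heights are at most 0, so the one bound for all heights below 1 covers every n.
    have h1 := hwt (-n / (2 * Real.pi))
    rw [mul_div_cancel₀ _ (by positivity)] at h1
    rw [h1]
    refine hC _ (lt_of_le_of_lt ?_ one_pos)
    exact div_nonpos_of_nonpos_of_nonneg (by simp) (by positivity)
  have hfw : ∀ a : ℝ, 0 ≤ a → halfLineSq a f < ∞ := fun a _ => by
    refine (setLIntegral_le_lintegral _ _).trans_lt ?_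
    have h1 := hwt (a / (2 * Real.pi))
    rw [mul_div_cancel₀ _ (by positivity)] at h1
    rw [h1, ← eLpNorm_two_sq]
    exact ENNReal.pow_lt_top (memLp_horizontal hH hHb _).2
  refine ⟨f, hfm, hfw, ?_⟩
  have hind : (f : ℝ → ℂ) =ᵐ[volume]
      (Set.Ioi 0).indicator fun x : ℝ => (Real.exp (0 * x) : ℂ) * f x := by
    filter_upwards [hf0, Measure.ae_ne volume (0 : ℝ)] with t ht ht0
    rcases lt_or_gt_of_ne ht0 with h | h
    · rw [ht h, Set.indicator_of_notMem (by simpa using h.le)]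
    · simp [Set.indicator_of_mem (Set.mem_Ioi.2 h)]
  have hf1 : Integrable f := by
    refine Integrable.congr ?_ hind.symm
    exact (integrable_indicator_iff measurableSet_Ioi).2
      (integrable_exp_mul hfm.aestronglyMeasurable hfw 0)
  have hFf : (𝓕 (f : ℝ → ℂ)) =ᵐ[volume] fun x : ℝ => H (x + (0 : ℝ) * I) := by
    have h1 := fourier_toLp_ae_eq hf1 (Lp.memLp f)
    rw [Lp.toLp_coeFn, hf, fourier_fourierInv_eq] at h1
    exact h1.symm.trans (memLp_horizontal hH hHb 0).coeFn_toLp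
  have hscale : ∀ᵐ ξ : ℝ, halfLineFourier f (2 * Real.pi * ξ : ℝ) = G (2 * Real.pi * ξ : ℝ) := by
    filter_upwards [hFf] with ξ hξ
    rw [Real.fourier_congr_ae hind, fourier_indicator_eq_halfLineFourier] at hξ
    simpa [hHdef] using hξ
  have hFc := (differentiable_halfLineFourier hfm.aestronglyMeasurable hfw).continuous
  -- Both sides are continuous, so the identity holds at every real point and survives the
  -- rescaling.
  have hall := (Continuous.ae_eq_iff_eq volume (by fun_prop) (by fun_prop)).1 hscale
  refine ae_of_all _ fun x => ?_
  have := congrFun hall (x / (2 * Real.pi))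
  simpa only [mul_div_cancel₀ x (by positivity : (2 * Real.pi) ≠ 0)] using this

end HalfLine

/-! ### Gluing the lines and rays, and the theorem. -/

section Assembly

open Filter Topology

/-- The index of the complex conjugate (equivalently, inverse) cube root of unity. -/
def conjIndex : Fin 3 → Fin 3 := ![0, 2, 1]

theorem conjIndex_conjIndex (k : Fin 3) : conjIndex (conjIndex k) = k := by
  fin_cases k <;> rfl

theorem ofReal_sqrt_three_sq : (Real.sqrt 3 : ℂ) ^ 2 = 3 := by
  rw [← Complex.ofReal_pow, Real.sq_sqrt (by norm_num)]
  norm_num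

theorem zeta_mul_zeta_conjIndex (k : Fin 3) : zeta k * zeta (conjIndex k) = 1 := by
  fin_cases k
  · simp [zeta, conjIndex]
  · simp [zeta, conjIndex]
    linear_combination (-(Real.sqrt 3 : ℂ) ^ 2 / 4) * I_sq + ofReal_sqrt_three_sq / 4
  · simp [zeta, conjIndex]
    linear_combination (-(Real.sqrt 3 : ℂ) ^ 2 / 4) * I_sq + ofReal_sqrt_three_sq / 4

/-- Distinct lines meet only at 0, so the test in `glue` singles out one line away from the origin.
-/
theorem im_zeta_mul_zeta_conjIndex {j k : Fin 3} (h : j ≠ k) :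
    (zeta j * zeta (conjIndex k)).im ≠ 0 := by
  have h3 : Real.sqrt 3 ≠ 0 := by positivity
  fin_cases j <;> fin_cases k <;> first | exact absurd rfl h | skip
  all_goals
    simp [zeta, conjIndex]
  all_goals
    intro h0
    exact h3 (by linarith)

/-- The function on the union of the lines `L_{ζ_k}` with prescribed values on each of them. -/
def glue (u : Fin 3 → ℝ → ℂ) (z : ℂ) : ℂ :=
  ∑ k : Fin 3, if (z * zeta (conjIndex k)).im = 0 then u k (z * zeta (conjIndex k)).re else 0

theorem measurable_glue {u : Fin 3 → ℝ → ℂ} (hu : ∀ k, Measurable (u k)) : Measurable (glue u) := by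
  unfold glue
  refine Finset.measurable_fun_sum _ fun k _ => Measurable.ite ?_ ?_ measurable_const
  · exact (measurableSet_singleton (0 : ℝ)).preimage (by fun_prop)
  · exact (hu k).comp (by fun_prop)

theorem glue_mul_zeta (u : Fin 3 → ℝ → ℂ) (j : Fin 3) {x : ℝ} (hx : x ≠ 0) :
    glue u ((x : ℂ) * zeta j) = u j x := by
  rw [glue, Finset.sum_eq_single j]
  · simp [mul_assoc, zeta_mul_zeta_conjIndex]
  · intro k _ hk
    rw [if_neg]
    rw [mul_assoc, Complex.im_ofReal_mul]
    exact mul_ne_zero hx (im_zeta_mul_zeta_conjIndex hk.symm)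
  · simp

theorem glue_add (u v : Fin 3 → ℝ → ℂ) : glue (u + v) = glue u + glue v := by
  ext z
  simp only [glue, Pi.add_apply, ← Finset.sum_add_distrib]
  refine Finset.sum_congr rfl fun k _ => ?_
  split_ifs <;> simp

theorem glue_smul (c : ℂ) (u : Fin 3 → ℝ → ℂ) : glue (c • u) = c • glue u := by
  ext z
  simp only [glue, Pi.smul_apply, Finset.smul_sum]
  refine Finset.sum_congr rfl fun k _ => ?_
  split_ifs <;> simp

theorem lintegral_rayMeasure_sq {f : ℂ → ℂ} (hf : Measurable f) :
    ∫⁻ z, ‖f z‖ₑ ^ 2 ∂rayMeasure = ∑ k : Fin 3, weightedSq 0 k f := by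
  rw [rayMeasure, lintegral_finsetSum_measure]
  refine Finset.sum_congr rfl fun k _ => ?_
  rw [lintegral_map (by fun_prop) (measurable_mul_zeta k), weightedSq]
  simp

theorem lintegral_lineMeasure_sq {f : ℂ → ℂ} (hf : Measurable f) :
    ∫⁻ z, ‖f z‖ₑ ^ 2 ∂lineMeasure = ∑ k : Fin 3, ∫⁻ x : ℝ, ‖f ((x : ℂ) * zeta k)‖ₑ ^ 2 := by
  rw [lineMeasure, lintegral_finsetSum_measure]
  refine Finset.sum_congr rfl fun k _ => ?_
  rw [lintegral_map (by fun_prop) (measurable_mul_zeta k)]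

theorem ae_line_of_ae {p : ℂ → Prop} (h : ∀ᵐ z ∂lineMeasure, p z) (k : Fin 3) :
    ∀ᵐ x : ℝ, p ((x : ℂ) * zeta k) := by
  refine ae_of_ae_map (measurable_mul_zeta k).aemeasurable ?_
  rw [lineMeasure, ae_finsetSum_measure_iff] at h
  exact h k (Finset.mem_univ k)

theorem enorm_sq_L2Rays (f : L2Rays) : ‖f‖ₑ ^ 2 = ∑ k : Fin 3, weightedSq 0 k f := by
  rw [Lp.enorm_def, eLpNorm_two_sq, lintegral_rayMeasure_sq (Lp.stronglyMeasurable f).measurable]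

theorem HardyEntire.enorm_sq {k : Fin 3} (g : HardyEntire k) :
    ‖g‖ₑ ^ 2 = ∫⁻ x : ℝ, ‖g ((x : ℂ) * zeta k)‖ₑ ^ 2 := by
  have h : ‖g‖ₑ = ‖HardyEntire.toLine k g‖ₑ := enorm_eq_iff_norm_eq.2 rfl
  rw [h, Lp.enorm_def, ← eLpNorm_two_sq]
  exact congrArg (· ^ 2) (eLpNorm_congr_ae g.memLp_line.coeFn_toLp)

theorem enorm_sq_hardyEntireSum (g : HardyEntireSum) :
    ‖g‖ₑ ^ 2 = ∑ k : Fin 3, ∫⁻ x : ℝ, ‖g k ((x : ℂ) * zeta k)‖ₑ ^ 2 := by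
  simp only [← HardyEntire.enorm_sq]
  have h := PiLp.norm_sq_eq_of_L2 (fun k : Fin 3 => HardyEntire k) g
  simp only [← ofReal_norm, ← ENNReal.ofReal_pow (norm_nonneg _)]
  rw [h, ENNReal.ofReal_sum_of_nonneg fun _ _ => by positivity]

/-- The function on the lines that equals `g k` on `L_{ζ_k}`. -/
def lineGlue (g : HardyEntireSum) : ℂ → ℂ := glue fun k x => g k ((x : ℂ) * zeta k)

theorem measurable_lineGlue (g : HardyEntireSum) : Measurable (lineGlue g) :=
  measurable_glue fun k => (g k).continuous_line.measurable

theorem ae_lineGlue (g : HardyEntireSum) (k : Fin 3) :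
    ∀ᵐ x : ℝ, lineGlue g ((x : ℂ) * zeta k) = g k ((x : ℂ) * zeta k) := by
  filter_upwards [Measure.ae_ne volume (0 : ℝ)] with x hx
  exact glue_mul_zeta _ k hx

theorem lintegral_lineGlue (g : HardyEntireSum) :
    ∫⁻ z, ‖lineGlue g z‖ₑ ^ 2 ∂lineMeasure = ‖g‖ₑ ^ 2 := by
  rw [lintegral_lineMeasure_sq (measurable_lineGlue g), enorm_sq_hardyEntireSum]
  refine Finset.sum_congr rfl fun k _ => lintegral_congr_ae ?_
  filter_upwards [ae_lineGlue g k] with x hx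
  rw [hx]

theorem memLp_lineGlue (g : HardyEntireSum) : MemLp (lineGlue g) 2 lineMeasure :=
  memLp_two_of_lintegral_lt_top (measurable_lineGlue g).aestronglyMeasurable (by
    rw [lintegral_lineGlue]; simp)

/-- The isometric embedding of the Hardy sum into `L²(L)`. -/
def lineEmbedding : HardyEntireSum →ₗᵢ[ℂ] L2Lines where
  toFun g := (memLp_lineGlue g).toLp _
  map_add' f g := by
    rw [← MemLp.toLp_add]
    congr 1
    exact glue_add _ _
  map_smul' c g := by
    rw [RingHom.id_apply, ← MemLp.toLp_const_smul]
    congr 1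
    exact glue_smul _ _
  norm_map' g := by
    refine enorm_eq_iff_norm_eq.1 ((ENNReal.pow_right_strictMono two_ne_zero).injective ?_)
    change ‖(memLp_lineGlue g).toLp _‖ₑ ^ 2 = _
    rw [Lp.enorm_def, eLpNorm_congr_ae (memLp_lineGlue g).coeFn_toLp, eLpNorm_two_sq,
      lintegral_lineGlue]

theorem ae_lineEmbedding (g : HardyEntireSum) (k : Fin 3) :
    ∀ᵐ x : ℝ, lineEmbedding g ((x : ℂ) * zeta k) = g k ((x : ℂ) * zeta k) := by
  filter_upwards [ae_line_of_ae (memLp_lineGlue g).coeFn_toLp k, ae_lineGlue g k] with x h1 h2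
  exact h1.trans h2

theorem rayFourier_eq_halfLineFourier (k : Fin 3) (f : ℂ → ℂ) (w : ℂ) :
    rayFourier k f w = halfLineFourier (fun x : ℝ => f ((x : ℂ) * zeta k)) (w * zeta k) := by
  simp only [rayFourier, halfLineFourier, mul_assoc]

theorem rayFourier_congr {k : Fin 3} {f g : ℂ → ℂ} (h : f =ᵐ[rayMeasure] g) (w : ℂ) :
    rayFourier k f w = rayFourier k g w := by
  refine integral_congr_ae ?_
  filter_upwards [ae_ray_of_ae h k] with x hx
  rw [hx]

namespace L2RaysInfty

theorem aestronglyMeasurable_ray (f : L2RaysInfty) (k : Fin 3) :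
    AEStronglyMeasurable (fun x : ℝ => f.1 ((x : ℂ) * zeta k))
      (volume.restrict (Set.Ioi (0 : ℝ))) :=
  ((Lp.stronglyMeasurable f.1).comp_measurable (measurable_mul_zeta k)).aestronglyMeasurable

theorem halfLineSq_lt_top (f : L2RaysInfty) (k : Fin 3) (a : ℝ) (ha : 0 ≤ a) :
    halfLineSq a (fun x : ℝ => f.1 ((x : ℂ) * zeta k)) < ∞ :=
  ENNReal.sum_lt_top.1 (f.2 a ha) k (Finset.mem_univ k)

theorem integrableOn_exp_mul (f : L2RaysInfty) (k : Fin 3) (w : ℂ) :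
    IntegrableOn (fun x : ℝ => cexp (-I * w * zeta k * x) * f.1 ((x : ℂ) * zeta k))
      (Set.Ioi 0) := by
  simpa only [mul_assoc] using integrableOn_exp_I_mul (aestronglyMeasurable_ray f k)
    (halfLineSq_lt_top f k) (w * zeta k)

/-- At the point ζ_k η the transform along the conjugate ray is the half-line transform at η; its
line integrals increase with Im η, so the weight at a bounds them all. -/
theorem isHardyMinus_rayFourier (f : L2RaysInfty) (k : Fin 3) {a : ℝ} (ha : 0 ≤ a) :
    IsHardyMinus k a (rayFourier (conjIndex k) f.1) := by
  have hm := aestronglyMeasurable_ray f (conjIndex k)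
  have hw := halfLineSq_lt_top f (conjIndex k)
  have hd := differentiable_halfLineFourier hm hw
  have hC : ENNReal.ofReal (2 * Real.pi) *
      halfLineSq a (fun x : ℝ => f.1 ((x : ℂ) * zeta (conjIndex k))) < ∞ :=
    ENNReal.mul_lt_top ENNReal.ofReal_lt_top (hw a ha)
  refine ⟨?_, (ENNReal.ofReal (2 * Real.pi) *
      halfLineSq a (fun x : ℝ => f.1 ((x : ℂ) * zeta (conjIndex k)))).toNNReal, fun ν hν => ?_⟩
  · simp only [funext (rayFourier_eq_halfLineFourier (conjIndex k) f.1)]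
    exact (hd.comp (differentiable_id.mul_const _)).differentiableOn
  · rw [ENNReal.coe_toNNReal hC.ne]
    calc _ = ∫⁻ x : ℝ, ‖halfLineFourier (fun x : ℝ => f.1 ((x : ℂ) * zeta (conjIndex k)))
          (x + ν * I)‖ₑ ^ 2 := by
          refine lintegral_congr fun x => ?_
          rw [rayFourier_eq_halfLineFourier, mul_right_comm, zeta_mul_zeta_conjIndex, one_mul]
      _ ≤ _ := by
          rw [lintegral_halfLineFourier_sq hm hw]
          gcongr
          exact halfLineSq_mono hν.le

/-- The Fourier transform along the ray `l_{ζ̄_k}` as an element of `HE²₋(ζ_k)`. -/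
def toHardyEntire (k : Fin 3) (f : L2RaysInfty) : HardyEntire k :=
  (⟨rayFourier (conjIndex k) f.1, fun _ ha => isHardyMinus_rayFourier f k ha⟩ :
    hardyEntireSubmodule k)

theorem toHardyEntire_apply (k : Fin 3) (f : L2RaysInfty) (w : ℂ) :
    toHardyEntire k f w = rayFourier (conjIndex k) f.1 w := rfl

theorem rayFourier_add (f g : L2RaysInfty) (k : Fin 3) (w : ℂ) :
    rayFourier k (f + g).1 w = rayFourier k f.1 w + rayFourier k g.1 w := by
  rw [show (f + g).1 = f.1 + g.1 from rfl, rayFourier_congr (Lp.coeFn_add f.1 g.1), rayFourier, rayFourier, rayFourier,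
    ← integral_add (integrableOn_exp_mul f k w) (integrableOn_exp_mul g k w)]
  simp only [Pi.add_apply, mul_add]

theorem rayFourier_smul (c : ℂ) (f : L2RaysInfty) (k : Fin 3) (w : ℂ) :
    rayFourier k (c • f).1 w = c * rayFourier k f.1 w := by
  rw [show (c • f).1 = c • f.1 from rfl, rayFourier_congr (Lp.coeFn_smul c f.1), rayFourier, rayFourier, ← integral_const_mul]
  refine integral_congr_ae (ae_of_all _ fun x => ?_)
  simp only [Pi.smul_apply, smul_eq_mul]
  ring

/-- The Fourier transform of `L²(l, ∞)` into the Hardy sum, as a linear map. -/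
def fourierLinearMap : L2RaysInfty →ₗ[ℂ] HardyEntireSum where
  toFun f := WithLp.toLp 2 fun k => toHardyEntire k f
  map_add' f g := by
    ext k
    exact HardyEntire.ext_toFun fun w => rayFourier_add f g (conjIndex k) w
  map_smul' c f := by
    ext k
    exact HardyEntire.ext_toFun fun w => rayFourier_smul c f (conjIndex k) w

theorem fourierLinearMap_apply (f : L2RaysInfty) (k : Fin 3) (w : ℂ) :
    fourierLinearMap f k w = rayFourier (conjIndex k) f.1 w := rfl

theorem enorm_sq_toHardyEntire (k : Fin 3) (f : L2RaysInfty) :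
    ‖toHardyEntire k f‖ₑ ^ 2 = ENNReal.ofReal (2 * Real.pi) * weightedSq 0 (conjIndex k) f.1 := by
  have h := lintegral_halfLineFourier_sq (aestronglyMeasurable_ray f (conjIndex k))
    (halfLineSq_lt_top f (conjIndex k)) 0
  rw [HardyEntire.enorm_sq]
  refine Eq.trans (lintegral_congr fun x => ?_) h
  rw [toHardyEntire_apply, rayFourier_eq_halfLineFourier, mul_assoc, zeta_mul_zeta_conjIndex]
  simp

theorem norm_fourierLinearMap_sq (f : L2RaysInfty) :
    ‖fourierLinearMap f‖ ^ 2 = 2 * Real.pi * ‖f‖ ^ 2 := by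
  have h : ‖fourierLinearMap f‖ₑ ^ 2 = ENNReal.ofReal (2 * Real.pi) * ‖f.1‖ₑ ^ 2 := by
    rw [enorm_sq_hardyEntireSum, enorm_sq_L2Rays]
    simp only [← HardyEntire.enorm_sq]
    have hk : ∀ k, ‖fourierLinearMap f k‖ₑ ^ 2 =
        ENNReal.ofReal (2 * Real.pi) * weightedSq 0 (conjIndex k) f.1 := fun k =>
      enorm_sq_toHardyEntire k f
    simp only [hk, ← Finset.mul_sum]
    congr 1
    -- `conjIndex` only exchanges the last two summands.
    simp only [Fin.sum_univ_three]
    exact add_right_comm _ _ _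
  rw [← ofReal_norm, ← ofReal_norm, ← ENNReal.ofReal_pow (norm_nonneg _),
    ← ENNReal.ofReal_pow (norm_nonneg _), ← ENNReal.ofReal_mul (by positivity),
    ENNReal.ofReal_eq_ofReal_iff (by positivity) (by positivity)] at h
  exact h

theorem fourierLinearMap_injective : Function.Injective fourierLinearMap := by
  rw [injective_iff_map_eq_zero]
  intro f hf
  have h := norm_fourierLinearMap_sq f
  rw [hf, norm_zero] at h
  have hpi := Real.pi_pos
  simpa [hpi.ne'] using h

/-- Functions on the half-line with finite weighted norms assemble to an element of `L²(l, ∞)`. -/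
theorem exists_of_rays {u : Fin 3 → ℝ → ℂ} (hu : ∀ k, Measurable (u k))
    (hw : ∀ k (a : ℝ), 0 ≤ a → halfLineSq a (u k) < ∞) :
    ∃ f : L2RaysInfty, ∀ k, ∀ᵐ x : ℝ ∂(volume.restrict (Set.Ioi (0 : ℝ))),
      f.1 ((x : ℂ) * zeta k) = u k x := by
  have hg : ∀ k, ∀ᵐ x : ℝ ∂(volume.restrict (Set.Ioi (0 : ℝ))),
      glue u ((x : ℂ) * zeta k) = u k x := fun k =>
    (ae_restrict_iff' measurableSet_Ioi).2 (ae_of_all _ fun x hx =>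
      glue_mul_zeta u k (ne_of_gt hx))
  have hsq : ∀ (a : ℝ) k, weightedSq a k (glue u) = halfLineSq a (u k) := fun a k => by
    refine lintegral_congr_ae ?_
    filter_upwards [hg k] with x hx
    rw [hx]
  have hm : MemLp (glue u) 2 rayMeasure := by
    refine memLp_two_of_lintegral_lt_top (measurable_glue hu).aestronglyMeasurable ?_
    rw [lintegral_rayMeasure_sq (measurable_glue hu)]
    exact ENNReal.sum_lt_top.2 fun k _ => by rw [hsq]; exact hw k 0 le_rfl
  refine ⟨⟨hm.toLp _, fun a ha => ENNReal.sum_lt_top.2 fun k _ => ?_⟩, fun k => ?_⟩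
  · rw [weightedSq_congr hm.coeFn_toLp, hsq]
    exact hw k a ha
  · filter_upwards [ae_ray_of_ae hm.coeFn_toLp k, hg k] with x h1 h2
    exact h1.trans h2

theorem fourierLinearMap_surjective : Function.Surjective fourierLinearMap := by
  intro g
  have hPW : ∀ k : Fin 3, ∃ φ : ℝ → ℂ, StronglyMeasurable φ ∧
      (∀ a : ℝ, 0 ≤ a → halfLineSq a φ < ∞) ∧
      ∀ᵐ x : ℝ, halfLineFourier φ x = g k (zeta k * x) := fun k =>
    exists_halfLineFourier_ae_eq (G := fun η => g k (zeta k * η))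
      ((g k).differentiable.comp (differentiable_id.const_mul _))
      fun a ha => ((g k).isHardyMinus ha).2
  choose φ hφ hw hF using hPW
  -- The function found for the k-th component belongs on the conjugate ray; `conjIndex` is an
  -- involution.
  obtain ⟨f, hf⟩ := exists_of_rays (u := fun k => φ (conjIndex k))
    (fun k => (hφ _).measurable) (fun k => hw _)
  refine ⟨f, ?_⟩
  ext k
  -- By the identity theorem it suffices to compare the entire functions on their own line.
  refine HardyEntire.toLine_injective k ?_
  refine (MemLp.toLp_eq_toLp_iff (fourierLinearMap f k).memLp_line (g k).memLp_line).2 ?_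
  filter_upwards [hF k] with x hx
  rw [fourierLinearMap_apply, rayFourier_eq_halfLineFourier, mul_assoc, zeta_mul_zeta_conjIndex,
    mul_one, mul_comm (x : ℂ), ← hx]
  refine integral_congr_ae ?_
  have := hf (conjIndex k)
  simp only [conjIndex_conjIndex] at this
  filter_upwards [this] with t ht
  rw [ht]

theorem norm_fourierLinearMap (f : L2RaysInfty) :
    ‖fourierLinearMap f‖ = Real.sqrt (2 * Real.pi) * ‖f‖ := by
  rw [← Real.sqrt_sq (norm_nonneg (fourierLinearMap f)), norm_fourierLinearMap_sq,
    Real.sqrt_mul (by positivity), Real.sqrt_sq (norm_nonneg f)]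

/-- The Fourier transform as a linear homeomorphism of `L²(l, ∞)` onto the Hardy sum. -/
def fourierEquiv : L2RaysInfty ≃L[ℂ] HardyEntireSum :=
  -- Scaling norms by a positive constant makes the inverse continuous, with no appeal to
  -- completeness.
  ContinuousLinearEquiv.ofHomothety
    (LinearEquiv.ofBijective fourierLinearMap
      ⟨fourierLinearMap_injective, fourierLinearMap_surjective⟩)
    (Real.sqrt (2 * Real.pi)) (by positivity) norm_fourierLinearMap

end L2RaysInfty

end Assembly

end

theorem theorem1p4 :
    (∃ J : HardyEntireSum →ₗᵢ[ℂ] L2Lines, ∀ (g : HardyEntireSum) (k : Fin 3),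
      ∀ᵐ x : ℝ, J g ((x : ℂ) * zeta k) = g k ((x : ℂ) * zeta k)) ∧
    (∀ f : L2RaysInfty, ∀ (k : Fin 3) (w : ℂ),
      MeasureTheory.IntegrableOn (fun x : ℝ =>
        Complex.exp (-Complex.I * w * zeta k * x) * f.1 ((x : ℂ) * zeta k)) (Set.Ioi 0)) ∧
    ∃ T : L2RaysInfty ≃L[ℂ] HardyEntireSum,
      (∀ (f : L2RaysInfty) (w : ℂ),
        T f 0 w = rayFourier 0 f.1 w ∧
        T f 2 w = rayFourier 1 f.1 w ∧
        T f 1 w = rayFourier 2 f.1 w) ∧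
      ∀ f : L2RaysInfty, ‖T f‖ ^ 2 = 2 * Real.pi * ‖f‖ ^ 2 :=
  ⟨⟨lineEmbedding, ae_lineEmbedding⟩, L2RaysInfty.integrableOn_exp_mul, L2RaysInfty.fourierEquiv,
    fun _ _ => ⟨rfl, rfl, rfl⟩, L2RaysInfty.norm_fourierLinearMap_sq⟩
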